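/- A hypergraph on $[n]=\{1,\dots,n\}$ is a pair $H=([n],E)$, where $E$ is a finite multiset of subsets of $[n]$, each with at least two elements (the elements of $E$, counted with multiplicity, are the edges; copies of a repeated edge are distinct edges). A walk is a sequence $v_0,e_1,v_1,\dots,e_m,v_m$ ($m\ge 0$) of vertices $v_i$ and edges $e_i$ with $\{v_{i-1},v_i\}\subseteq e_i$ for $1\le i\le m$. It is a path if all $v_i$ are distinct and all $e_i$ are distinct, and a cycle if $m\ge 2$, all $e_i$ are distinct, and all $v_i$ are distinct except that $v_0=v_m$. A hypertree is a hypergraph without cycles in which any two vertices are joined by a path. A rooted hypertree on $[n]$ is a hypertree on $[n]$ (with labeled vertices and unlabeled edges) together with a choice of one of its vertices as root. Let $n\ge 1$. Then for every integer $k\ge 0$ the number of rooted hypertrees on $[n]$ with exactly $k$ edges is $n^k S(n-1,k)$, where $S(\cdot,\cdot)$ denotes the Stirling numbers of the second kind (with $S(0,0)=1$). In particular, the total number of rooted hypertrees on $[n]$ is finite and equal to $\sum_{k=0}^{n-1} n^k S(n-1,k)$. -/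

import Mathlib

/-- A hypergraph (without loops, repeated edges allowed) with vertex set `V`: a finite multiset of
finite subsets of `V`, each of which has at least two elements. -/
structure MultiHypergraph (V : Type*) where
  /-- The multiset of edges. -/
  edges : Multiset (Finset V)
  /-- Every edge contains at least two vertices. -/
  two_le_card : ∀ e ∈ edges, 2 ≤ e.card

namespace MultiHypergraph

/-- The edges of `H`, where the copies of a repeated edge count as distinct edges. The set of
vertices of `e : H.Edge` is `e.1`. -/
abbrev Edge {V : Type*} [DecidableEq V] (H : MultiHypergraph V) : Type _ := H.edges.ToType

/-- A walk `v 0, e 0, v 1, e 1, …, e (m - 1), v m` with `m` edges: both `v i` and `v (i + 1)`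
belong to `e i`. -/
structure Walk {V : Type*} [DecidableEq V] (H : MultiHypergraph V) where
  /-- The number of edges of the walk. -/
  length : ℕ
  /-- The vertices of the walk. -/
  vert : Fin (length + 1) → V
  /-- The edges of the walk. -/
  edge : Fin length → H.Edge
  /-- Each edge contains the vertex before it. -/
  left_mem : ∀ i : Fin length, vert i.castSucc ∈ (edge i).1
  /-- Each edge contains the vertex after it. -/
  right_mem : ∀ i : Fin length, vert i.succ ∈ (edge i).1

/-- A path is a walk whose vertices are all distinct and whose edges are all distinct. -/
def Walk.IsPath {V : Type*} [DecidableEq V] {H : MultiHypergraph V} (w : H.Walk) : Prop :=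
  Function.Injective w.vert ∧ Function.Injective w.edge

/-- A cycle is a walk with at least two edges, whose edges are all distinct, and whose vertices are
all distinct except that the last one equals the first one. -/
def Walk.IsCycle {V : Type*} [DecidableEq V] {H : MultiHypergraph V} (w : H.Walk) : Prop :=
  2 ≤ w.length ∧ Function.Injective w.edge ∧ w.vert 0 = w.vert (Fin.last w.length) ∧
    Function.Injective fun i : Fin w.length => w.vert i.castSucc

/-- A hypergraph is connected if any two vertices are joined by a path. -/
def Connected {V : Type*} [DecidableEq V] (H : MultiHypergraph V) : Prop :=
  ∀ x y : V, ∃ w : H.Walk, w.IsPath ∧ w.vert 0 = x ∧ w.vert (Fin.last w.length) = y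

/-- A hypertree is a connected hypergraph without cycles. -/
def IsHypertree {V : Type*} [DecidableEq V] (H : MultiHypergraph V) : Prop :=
  H.Connected ∧ ∀ w : H.Walk, ¬ w.IsCycle

end MultiHypergraph

/-- The rooted hypertrees with vertex set `V`: pairs of a hypertree with vertex set `V` and one of
its vertices, the root. -/
def rootedHypertrees (V : Type*) [DecidableEq V] : Set (MultiHypergraph V × V) :=
  {p | p.1.IsHypertree}

/-! Fix a root `r`. In a hypertree each edge `e` has a unique vertex `p e` nearest to `r`, and each
vertex `v ≠ r` lies in a unique edge `f v` leading towards `r`, so `e` consists of `p e` and the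
fibre of `f` over `e`. Conversely, such data give a hypertree as soon as `p` is acyclic
(`IsRootedBy`, with `IsRootedBy.isHypertree` and `MultiHypergraph.IsHypertree.exists_isRootedBy`),
and they are determined by the edges and the root (`IsRootedBy.unique`).

With `k` labelled edges, `f` is a surjection from the `n - 1` other vertices onto the labels, which
gives `k! S(n-1,k)` choices (`card_surjective`). For fixed `f`, a weighted Cayley formula
(`card_acyclicParent`) shows that `n` times the number of acyclic `p` is `n ^ k`, as only `r` is
unlabelled. Summing over the `n` roots gives `n ^ k k! S(n-1,k)`. The edges of a hypertree are
distinct (`IsRootedBy.injective`), so forgetting the labels divides by exactly `k!`. -/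

/-! ### Counting acyclic parent functions -/

/-- A parent function `p` on the classes of the partial labelling `f` is acyclic if some rank
function strictly decreases along parents. -/
def AcyclicParent {X B : Type*} (f : X → Option B) (p : B → X) : Prop :=
  ∃ h : B → ℕ, ∀ i j, f (p i) = some j → h j < h i

/-- Merge the class `none` of `f` into the class of `v`. -/
def mergeClass {X C : Type*} [DecidableEq C] (f : X → Option (Option C)) (v x : X) : Option C :=
  if f x = some none then (f v).join else (f x).join

/-- Contracting the arc from the class `none` to its parent's class neither creates nor destroys
cycles, unless that arc is a loop. This drives the induction on the number of classes. -/
theorem acyclicParent_option_iff {X C : Type*} [DecidableEq C] (f : X → Option (Option C))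
    (p : Option C → X) :
    AcyclicParent f p ↔ f (p none) ≠ some none ∧
      AcyclicParent (mergeClass f (p none)) (fun c => p (some c)) := by
  constructor
  · rintro ⟨h, hh⟩
    refine ⟨fun hn => (hh _ _ hn).false, fun c => h (some c), fun i j hij => ?_⟩
    unfold mergeClass at hij
    split_ifs at hij with hi
    · rw [Option.join_eq_some_iff] at hij
      exact (hh _ _ hij).trans (hh _ _ hi)
    · rw [Option.join_eq_some_iff] at hij
      exact hh _ _ hij
  · rintro ⟨hn, h, hh⟩
    -- Old ranks become odd, so the class `none` fits just above its parent's class and still below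
    -- every class that lay above that one.
    refine ⟨fun o => o.elim ((f (p none)).join.elim 0 fun c => 2 * h c + 2)
      fun c => 2 * h c + 1, ?_⟩
    rintro (_ | i) (_ | j) hij
    · exact (hn hij).elim
    · simp [hij]
    · have := hh i
      unfold mergeClass at this
      simp only [hij, if_true] at this
      rcases hj : (f (p none)).join with _ | c
      · simp
      · have := this _ hj
        simp only [Option.elim]
        omega
    · have := hh i j (by simp [mergeClass, hij])
      simp only [Option.elim]
      omega

/-- Acyclic parent functions, split according to the parent of `none`. -/
def acyclicParentOptionEquiv {X C : Type*} [DecidableEq C] (f : X → Option (Option C)) :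
    {p : Option C → X // AcyclicParent f p} ≃
      Σ v : {v : X // f v ≠ some none}, {q : C → X // AcyclicParent (mergeClass f v) q} where
  toFun p := ⟨⟨p.1 none, ((acyclicParent_option_iff f p.1).1 p.2).1⟩,
    ⟨fun c => p.1 (some c), ((acyclicParent_option_iff f p.1).1 p.2).2⟩⟩
  invFun q := ⟨fun o => o.elim q.1.1 q.2.1, (acyclicParent_option_iff f _).2 ⟨q.1.2, q.2.2⟩⟩
  left_inv p := by ext (_ | c) <;> rfl
  right_inv q := rfl

theorem card_mergeClass_none {X C : Type*} [Fintype X] [DecidableEq C]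
    (f : X → Option (Option C)) {v : X} (hv : f v ≠ some none) :
    (Finset.univ.filter fun x => mergeClass f v x = none).card =
      (Finset.univ.filter fun x => f x = none).card +
        if f v = none then (Finset.univ.filter fun x => f x = some none).card else 0 := by
  classical
  split_ifs with h
  · rw [← Finset.card_union_of_disjoint]
    · congr 1
      ext x
      rcases hx : f x with _ | _ | c <;> simp [mergeClass, hx, h]
    · rw [Finset.disjoint_filter]
      intro x _ hx
      simp [hx]
  · rw [add_zero]
    congr 1
    ext x
    rcases hv' : f v with _ | _ | c
    · exact (h hv').elim
    · exact (hv hv').elim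
    · rcases hx : f x with _ | _ | c <;> simp [mergeClass, hx, hv']

/-- The number of acyclic parent functions, a weighted form of Cayley's formula. -/
theorem card_acyclicParent (X : Type*) [Fintype X] (B : Type*) [Finite B] :
    ∀ f : X → Option B, Nat.card {p : B → X // AcyclicParent f p} * Fintype.card X =
      Nat.card {x // f x = none} * Fintype.card X ^ Nat.card B := by
  classical
  refine Finite.induction_empty_option (P := fun B : Type _ =>
    ∀ f : X → Option B, Nat.card {p : B → X // AcyclicParent f p} * Fintype.card X =
      Nat.card {x // f x = none} * Fintype.card X ^ Nat.card B) ?_ ?_ ?_ B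
  · intro A B e ih f
    rw [← Nat.card_congr e]
    have h := ih fun x => (f x).map e.symm
    have h1 : Nat.card {p : A → X // AcyclicParent (fun x => (f x).map e.symm) p} =
        Nat.card {p : B → X // AcyclicParent f p} := by
      refine Nat.card_congr ((e.arrowCongr (Equiv.refl X)).subtypeEquiv fun p => ?_)
      constructor
      · rintro ⟨h, hh⟩
        refine ⟨fun b => h (e.symm b), fun i j hij => hh _ _ ?_⟩
        simp only [Equiv.arrowCongr_apply, Equiv.coe_refl, Function.comp_apply, id] at hij
        simp [hij]
      · rintro ⟨h, hh⟩
        refine ⟨fun a => h (e a), fun i j hij => hh _ _ ?_⟩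
        simpa [Option.map_eq_some_iff, Equiv.symm_apply_eq] using hij
    rw [← h1, h]
    congr 2
    simp
  · intro f
    have hf : ∀ x, f x = none := fun x => by rcases f x with _ | b; rfl; exact b.elim
    have : Nat.card {p : PEmpty → X // AcyclicParent f p} = 1 := by
      rw [Nat.card_eq_one_iff_unique]
      exact ⟨⟨fun a b => Subtype.ext (Subsingleton.elim _ _)⟩,
        ⟨⟨fun b => b.elim, fun _ => 0, fun b => b.elim⟩⟩⟩
    rw [this]
    simp [hf]
  · intro C _ ih f
    have : Fintype C := Fintype.ofFinite C
    rw [Nat.card_congr (acyclicParentOptionEquiv f), Nat.card_sigma, Finset.sum_mul,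
      Finset.sum_congr rfl fun v _ => ih _]
    simp only [Nat.card_eq_fintype_card, Fintype.card_subtype, Fintype.card_option]
    rw [← Finset.sum_mul, pow_succ', ← mul_assoc]
    congr 1
    -- With `N` unlabelled points and `M` points in the class `none`, the sum over the admissible
    -- parents is `(n - M) * N + N * M = n * N`.
    rw [Finset.sum_congr rfl fun v _ => card_mergeClass_none f v.2, Finset.sum_add_distrib,
      Finset.sum_const, smul_eq_mul, Finset.card_univ, Fintype.card_subtype,
      ← Finset.sum_subtype (Finset.univ.filter fun v => f v ≠ some none) (by simp)
        (fun v => if f v = none then (Finset.univ.filter fun x => f x = some none).card else 0),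
      ← Finset.sum_filter, Finset.sum_const, smul_eq_mul, Finset.filter_filter]
    have h1 : (Finset.univ.filter fun v => f v ≠ some none ∧ f v = none) =
        Finset.univ.filter fun v => f v = none := by
      ext v
      simp +contextual
    have h2 := Finset.card_filter_add_card_filter_not (s := Finset.univ) fun v => f v = some none
    rw [h1, ← Finset.card_univ, ← h2]
    simp only [ne_eq]
    ring

/-! ### Surjections and Stirling numbers -/

/-- The value at `none` is either taken elsewhere or not; the two cases are the two terms of the
Stirling recurrence. -/
theorem surjective_option_iff {A B : Type*} (g : Option A → B) :
    Function.Surjective g ↔ Function.Surjective (fun a => g (some a)) ∨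
      ∀ y, (∃ a, g (some a) = y) ↔ y ≠ g none := by
  constructor
  · intro h
    by_cases hn : ∃ a, g (some a) = g none
    · left
      intro y
      obtain ⟨_ | a, rfl⟩ := h y
      exacts [hn, ⟨a, rfl⟩]
    · right
      refine fun y => ⟨?_, fun hy => ?_⟩
      · rintro ⟨a, rfl⟩ h'
        exact hn ⟨a, h'⟩
      · obtain ⟨_ | a, rfl⟩ := h y
        exacts [(hy rfl).elim, ⟨a, rfl⟩]
  · rintro (h | h) y
    · obtain ⟨a, rfl⟩ := h y
      exact ⟨_, rfl⟩
    · by_cases hy : y = g none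
      · exact ⟨_, hy.symm⟩
      · obtain ⟨a, rfl⟩ := (h y).2 hy
        exact ⟨_, rfl⟩

/-- Surjections from `Option A`, split according to the value at `none`. -/
noncomputable def surjectiveOptionEquiv (A B : Type*) :
    {g : Option A → B // Function.Surjective g} ≃ Σ b : B,
      {g : A → B // Function.Surjective g} ⊕ {g : A → B // ∀ y, (∃ a, g a = y) ↔ y ≠ b} := by
  classical
  refine Equiv.trans (β := Σ b : B, {g : A → B // Function.Surjective g ∨
    ∀ y, (∃ a, g a = y) ↔ y ≠ b}) ⟨fun g => ⟨g.1 none, fun a => g.1 (some a),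
      (surjective_option_iff g.1).1 g.2⟩, fun g => ⟨fun o => o.elim g.1 g.2.1,
      (surjective_option_iff _).2 g.2.2⟩, fun g => ?_, fun g => rfl⟩
    (Equiv.sigmaCongrRight fun b => subtypeOrEquiv _ _ ?_)
  · ext (_ | a) <;> rfl
  · rw [Pi.disjoint_iff]
    intro g
    rw [Prop.disjoint_iff]
    rintro ⟨h1, h2⟩
    exact (h2 b).1 (h1 b) rfl

/-- Maps with range `{b}ᶜ` are surjections onto `{b}ᶜ`. -/
def rangeComplSingletonEquiv (A : Type*) {B : Type*} (b : B) :
    {g : A → B // ∀ y, (∃ a, g a = y) ↔ y ≠ b} ≃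
      {g : A → {y // y ≠ b} // Function.Surjective g} where
  toFun g := ⟨fun a => ⟨g.1 a, (g.2 _).1 ⟨a, rfl⟩⟩, fun y => by
    obtain ⟨a, ha⟩ := (g.2 y).2 y.2
    exact ⟨a, Subtype.ext ha⟩⟩
  invFun g := ⟨fun a => g.1 a, fun y => ⟨by rintro ⟨a, rfl⟩; exact (g.1 a).2, fun hy => by
    obtain ⟨a, ha⟩ := g.2 ⟨y, hy⟩
    exact ⟨a, congrArg Subtype.val ha⟩⟩⟩
  left_inv _ := rfl
  right_inv _ := rfl

/-- The number of surjections in terms of Stirling numbers of the second kind. -/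
theorem card_surjective.{u, v} (A : Type u) [Finite A] : ∀ (B : Type v) [Finite B],
    Nat.card {g : A → B // Function.Surjective g} =
      (Nat.card B).factorial * Nat.stirlingSecond (Nat.card A) (Nat.card B) := by
  classical
  refine Finite.induction_empty_option (P := fun A : Type u => ∀ (B : Type v) [Finite B],
    Nat.card {g : A → B // Function.Surjective g} =
      (Nat.card B).factorial * Nat.stirlingSecond (Nat.card A) (Nat.card B)) ?_ ?_ ?_ A
  · intro A A' e ih B _
    rw [← Nat.card_congr e, ← ih]
    refine Nat.card_congr ((e.symm.arrowCongr (Equiv.refl B)).subtypeEquiv fun g => ?_)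
    exact (Equiv.surjective_comp e g).symm
  · intro B _
    rcases isEmpty_or_nonempty B with hB | ⟨⟨b⟩⟩
    · have : Nat.card {g : PEmpty.{u + 1} → B // Function.Surjective g} = 1 := by
        rw [Nat.card_eq_one_iff_unique]
        exact ⟨⟨fun a b => Subtype.ext (Subsingleton.elim _ _)⟩,
          ⟨⟨fun b => b.elim, fun b => hB.elim b⟩⟩⟩
      rw [this]
      simp
    · have : IsEmpty {g : PEmpty.{u + 1} → B // Function.Surjective g} :=
        ⟨fun g => (g.2 b).choose.elim⟩
      have hB : Nat.card B ≠ 0 := Nat.card_ne_zero.2 ⟨⟨b⟩, inferInstance⟩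
      obtain ⟨k, hk⟩ := Nat.exists_eq_succ_of_ne_zero hB
      rw [hk]
      simp
  · intro A _ ih B _
    have : Fintype B := Fintype.ofFinite B
    have hA : Nat.card (Option A) = Nat.card A + 1 := by simp
    rw [Nat.card_congr (surjectiveOptionEquiv A B), Nat.card_sigma, hA]
    simp only [Nat.card_sum, Nat.card_congr (rangeComplSingletonEquiv A _), ih]
    rcases hk : Nat.card B with _ | k
    · have : IsEmpty B := Finite.card_eq_zero_iff.1 hk
      simp
    · have h (b : B) : Nat.card {y // y ≠ b} = k := by
        rw [Nat.card_eq_fintype_card] at hk ⊢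
        simp [Fintype.card_subtype_compl, hk]
      simp only [h, Finset.sum_const, Finset.card_univ, ← Nat.card_eq_fintype_card, hk, smul_eq_mul,
        Nat.stirlingSecond_succ_succ, Nat.factorial_succ]
      ring

/-! ### Paths and cycles through the link graph -/

namespace MultiHypergraph

/-- The graph joining distinct vertices that lie in a common edge from `S`. -/
def linkGraph {V : Type*} [DecidableEq V] (H : MultiHypergraph V) (S : Set H.Edge) :
    SimpleGraph V where
  Adj x y := x ≠ y ∧ ∃ e ∈ S, x ∈ e.1 ∧ y ∈ e.1
  symm := ⟨fun _ _ ⟨h, e, he, hx, hy⟩ => ⟨h.symm, e, he, hy, hx⟩⟩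
  loopless := ⟨fun _ h => h.1 rfl⟩

theorem linkGraph_reachable_of_mem {V : Type*} [DecidableEq V] {H : MultiHypergraph V}
    {S : Set H.Edge} {e : H.Edge} (he : e ∈ S) {x y : V} (hx : x ∈ e.1) (hy : y ∈ e.1) :
    (H.linkGraph S).Reachable x y := by
  by_cases h : x = y
  · rw [h]
  · exact SimpleGraph.Adj.reachable ⟨h, e, he, hx, hy⟩

theorem Walk.reachable {V : Type*} [DecidableEq V] {H : MultiHypergraph V} (w : H.Walk) :
    (H.linkGraph Set.univ).Reachable (w.vert 0) (w.vert (Fin.last w.length)) := by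
  have h : ∀ i, (H.linkGraph Set.univ).Reachable (w.vert 0) (w.vert i) := by
    intro i
    induction i using Fin.induction with
    | zero => rfl
    | succ i ih =>
      exact ih.trans (linkGraph_reachable_of_mem (Set.mem_univ _) (w.left_mem i) (w.right_mem i))
  exact h _

/-- Vertices connected through edges from `S` are joined by a path with edges from `S`. -/
theorem exists_isPath_of_reachable {V : Type*} [DecidableEq V] {H : MultiHypergraph V}
    {S : Set H.Edge} {x y : V} (h : (H.linkGraph S).Reachable x y) :
    ∃ w : H.Walk, w.IsPath ∧ w.vert 0 = x ∧ w.vert (Fin.last w.length) = y ∧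
      ∀ i, w.edge i ∈ S := by
  obtain ⟨p, hp⟩ := h.exists_walk_length_eq_dist
  have hE : ∀ i : Fin p.length, ∃ e ∈ S, p.getVert i ∈ e.1 ∧ p.getVert (i + 1) ∈ e.1 :=
    fun i => (p.adj_getVert_succ i.2).2
  choose E hES hl hr using hE
  refine ⟨⟨p.length, fun i => p.getVert i, E, fun i => by simpa using hl i,
    fun i => by simpa using hr i⟩, ⟨?_, ?_⟩, by simp, by simp, hES⟩
  · intro i j hij
    exact Fin.ext ((p.isPath_of_length_eq_dist hp).getVert_injOn (Nat.lt_succ_iff.1 i.2)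
      (Nat.lt_succ_iff.1 j.2) hij)
  -- An edge used twice on a shortest walk would allow a shortcut from its first entry to its last
  -- exit.
  · have key : ∀ i j : Fin p.length, i < j → E i ≠ E j := by
      intro i j hij he
      have hadj : (H.linkGraph S).Reachable (p.getVert i) (p.getVert (j + 1)) ∧
          (H.linkGraph S).dist (p.getVert i) (p.getVert (j + 1)) ≤ 1 := by
        by_cases hne : p.getVert i = p.getVert (j + 1)
        · rw [hne]
          simp
        · have : (H.linkGraph S).Adj (p.getVert i) (p.getVert (j + 1)) :=
            ⟨hne, E i, hES i, hl i, he ▸ hr j⟩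
          exact ⟨this.reachable, (SimpleGraph.dist_eq_one_iff_adj.2 this).le⟩
      obtain ⟨q, hq⟩ := hadj.1.exists_walk_length_eq_dist
      have := SimpleGraph.dist_le (((p.take i).append q).append (p.drop (j + 1)))
      simp only [SimpleGraph.Walk.length_append, SimpleGraph.Walk.take_length,
        SimpleGraph.Walk.drop_length] at this
      have h1 := hadj.2
      have h2 := i.2
      have h3 := j.2
      have h4 : (i : ℕ) < j := hij
      omega
    intro i j hij
    rcases lt_trichotomy i j with h | h | h
    exacts [(key i j h hij).elim, h, (key j i h hij.symm).elim]

/-- Without cycles, distinct vertices of an edge are disconnected by removing that edge. -/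
theorem not_reachable_of_forall_not_isCycle {V : Type*} [DecidableEq V] {H : MultiHypergraph V}
    (hH : ∀ w : H.Walk, ¬ w.IsCycle) {e : H.Edge} {x y : V} (hx : x ∈ e.1) (hy : y ∈ e.1)
    (hxy : x ≠ y) : ¬ (H.linkGraph {e}ᶜ).Reachable x y := by
  intro h
  obtain ⟨w, ⟨hv, hwe⟩, rfl, rfl, hS⟩ := exists_isPath_of_reachable h
  have hlen : w.length ≠ 0 := by
    intro h0
    apply hxy
    congr 1
    ext
    simp [h0]
  -- A path from `x` to `y` avoiding `e` is closed up to a cycle by `e`; it is nonempty, so the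
  -- cycle has at least two edges.
  refine hH ⟨w.length + 1, Fin.snoc w.vert (w.vert 0), Fin.snoc w.edge e, ?_, ?_⟩
    ⟨by simp only; omega, ?_, ?_, ?_⟩
  · intro i
    induction i using Fin.lastCases with
    | last => simpa using hy
    | cast i => simpa using w.left_mem i
  · intro i
    induction i using Fin.lastCases with
    | last => simpa using hx
    | cast i =>
      simp only [Fin.succ_castSucc, Fin.snoc_castSucc]
      exact w.right_mem i
  · intro i j hij
    induction i using Fin.lastCases with
    | last =>
      induction j using Fin.lastCases with
      | last => rfl
      | cast j =>
        simp only [Fin.snoc_last, Fin.snoc_castSucc] at hij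
        exact (hS j hij.symm).elim
    | cast i =>
      induction j using Fin.lastCases with
      | last =>
        simp only [Fin.snoc_last, Fin.snoc_castSucc] at hij
        exact (hS i hij).elim
      | cast j =>
        simp only [Fin.snoc_castSucc] at hij
        rw [hwe hij]
  · simp only [Fin.snoc_last]
    exact Fin.snoc_castSucc (α := fun _ => V) (w.vert 0) w.vert 0
  · simpa using hv

end MultiHypergraph

/-! ### Hypertrees as parent structures -/

/-- An indexed family `e` of subsets of `V` is described by the root `r`, the function `f` mapping
each vertex other than `r` to the edge joining it to its parent, and the function `p` giving the
vertex of each edge closest to the root. -/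
structure IsRootedBy {V ι : Type*} (e : ι → Finset V) (r : V) (f : V → Option ι) (p : ι → V) :
    Prop where
  mem_iff : ∀ j v, v ∈ e j ↔ v = p j ∨ f v = some j
  eq_none_iff : ∀ v, f v = none ↔ v = r
  exists_eq_some : ∀ j, ∃ v, f v = some j
  acyclic : AcyclicParent f p

namespace IsRootedBy

variable {V ι : Type*} {e : ι → Finset V} {r : V} {f : V → Option ι} {p : ι → V}

theorem parent_mem (h : IsRootedBy e r f p) (j : ι) : p j ∈ e j := (h.mem_iff _ _).2 (Or.inl rfl)

theorem parent_ne (h : IsRootedBy e r f p) (j : ι) : f (p j) ≠ some j := by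
  obtain ⟨g, hg⟩ := h.acyclic
  exact fun hj => (hg _ _ hj).false

theorem two_le_card (h : IsRootedBy e r f p) (j : ι) : 2 ≤ (e j).card := by
  obtain ⟨v, hv⟩ := h.exists_eq_some j
  refine Finset.one_lt_card.2 ⟨p j, h.parent_mem j, v, (h.mem_iff _ _).2 (Or.inr hv), ?_⟩
  rintro rfl
  exact h.parent_ne j hv

/-- If two labels carried the same edge, the parent vertex of each would lie in the class of the
other, and the ranks would decrease in both directions. -/
theorem injective (h : IsRootedBy e r f p) : Function.Injective e := by
  intro i j hij
  by_contra hne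
  have key : ∀ i j, e i = e j → i ≠ j → f (p j) = some i := by
    intro i j hij hne
    obtain ⟨v, hv⟩ := h.exists_eq_some i
    have : v ∈ e j := hij ▸ (h.mem_iff _ _).2 (Or.inr hv)
    rcases (h.mem_iff _ _).1 this with rfl | h'
    · exact hv
    · exact (hne (Option.some_injective _ (hv.symm.trans h'))).elim
  obtain ⟨g, hg⟩ := h.acyclic
  exact (hg _ _ (key i j hij hne)).asymm (hg _ _ (key j i hij.symm (Ne.symm hne)))

theorem comp_equiv {κ : Type*} (h : IsRootedBy e r f p) (φ : κ ≃ ι) :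
    IsRootedBy (e ∘ φ) r (fun v => (f v).map φ.symm) (p ∘ φ) := by
  have hφ : ∀ v j, (f v).map φ.symm = some j ↔ f v = some (φ j) := by
    intro v j
    simp [Option.map_eq_some_iff, Equiv.symm_apply_eq]
  refine ⟨fun j v => ?_, fun v => ?_, fun j => ?_, ?_⟩
  · rw [hφ]
    exact h.mem_iff _ _
  · rw [Option.map_eq_none_iff]
    exact h.eq_none_iff v
  · simpa only [hφ] using h.exists_eq_some (φ j)
  · obtain ⟨g, hg⟩ := h.acyclic
    exact ⟨g ∘ φ, fun i j hij => hg _ _ ((hφ _ _).1 hij)⟩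

/-- Induction on the rank of an edge: were `p j` not also its parent vertex in the second structure,
it would have label `j` there, hence not be the root, and the lower edge `f (p j)` would give a
contradiction. -/
theorem unique {f' : V → Option ι} {p' : ι → V} (h : IsRootedBy e r f p)
    (h' : IsRootedBy e r f' p') : f = f' ∧ p = p' := by
  have hp : ∀ j, p j = p' j := by
    obtain ⟨g, hg⟩ := h.acyclic
    intro j
    induction hn : g j using Nat.strong_induction_on generalizing j with
    | _ n ih =>
      by_contra hne
      have h1 : f' (p j) = some j := ((h'.mem_iff _ _).1 (h.parent_mem j)).resolve_left hne
      have h2 : f (p j) ≠ none := fun h0 => by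
        rw [h.eq_none_iff, ← h'.eq_none_iff, h1] at h0
        cases h0
      obtain ⟨i, hi⟩ := Option.ne_none_iff_exists'.1 h2
      have hpi := ih _ (hn ▸ hg _ _ hi) i rfl
      rcases (h'.mem_iff _ _).1 ((h.mem_iff i _).2 (Or.inr hi)) with h3 | h3
      · rw [← hpi] at h3
        rw [h3] at hi
        exact h.parent_ne i hi
      · rw [h1, Option.some_inj] at h3
        exact h.parent_ne j (h3 ▸ hi)
  refine ⟨funext fun v => ?_, funext hp⟩
  rcases hv : f v with _ | j
  · rw [h.eq_none_iff, ← h'.eq_none_iff] at hv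
    exact hv.symm
  · rcases (h'.mem_iff _ _).1 ((h.mem_iff j v).2 (Or.inr hv)) with h3 | h3
    · rw [← hp] at h3
      exact (h.parent_ne j (h3 ▸ hv)).elim
    · exact h3.symm

theorem isHypertree [DecidableEq V] {H : MultiHypergraph V} {f : V → Option H.Edge}
    {p : H.Edge → V} (h : IsRootedBy (fun e : H.Edge => e.1) r f p) : H.IsHypertree := by
  obtain ⟨g, hg⟩ := h.acyclic
  constructor
  · have hp : ∀ j, (H.linkGraph Set.univ).Reachable (p j) r := by
      intro j
      induction hn : g j using Nat.strong_induction_on generalizing j with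
      | _ n ih =>
        rcases hv : f (p j) with _ | i
        · rw [(h.eq_none_iff _).1 hv]
        · exact (MultiHypergraph.linkGraph_reachable_of_mem (Set.mem_univ i)
            ((h.mem_iff _ _).2 (Or.inr hv)) (h.parent_mem i)).trans (ih _ (hn ▸ hg _ _ hv) i rfl)
    have hr : ∀ v, (H.linkGraph Set.univ).Reachable v r := by
      intro v
      rcases hv : f v with _ | i
      · rw [(h.eq_none_iff _).1 hv]
      · exact (MultiHypergraph.linkGraph_reachable_of_mem (Set.mem_univ i)
          ((h.mem_iff _ _).2 (Or.inr hv)) (h.parent_mem i)).trans (hp i)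
    intro x y
    obtain ⟨w, hw, hx, hy, -⟩ :=
      MultiHypergraph.exists_isPath_of_reachable ((hr x).trans (hr y).symm)
    exact ⟨w, hw, hx, hy⟩
  · rintro ⟨m, v, E, hl, hr⟩ ⟨hm, hE, h0, hv⟩
    simp only at hm hE h0 hv
    obtain ⟨m, rfl⟩ := Nat.exists_eq_add_of_le' hm
    obtain ⟨i, -, hi⟩ := Finset.exists_max_image Finset.univ (fun i => g (E i)) ⟨0, by simp⟩
    -- In an edge of maximal rank on the cycle, only the parent vertex can belong to another edge of
    -- the cycle. Both cycle neighbours of this edge then coincide.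
    have key : ∀ x ∈ (E i).1, (∃ j, j ≠ i ∧ x ∈ (E j).1) → x = p (E i) := by
      rintro x hx ⟨j, hj, hxj⟩
      refine ((h.mem_iff _ _).1 hx).resolve_right fun hfx => ?_
      rcases (h.mem_iff _ _).1 hxj with rfl | hfj
      · exact (hg _ _ hfx).not_ge (hi j (Finset.mem_univ _))
      · exact hj (hE (Option.some_injective _ (hfj.symm.trans hfx)))
    have hleft := key _ (hl i) (by
      induction i using Fin.cases with
      | zero =>
        refine ⟨Fin.last _, by simp [Fin.ext_iff], ?_⟩
        have := hr (Fin.last _)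
        rwa [Fin.succ_last, ← h0] at this
      | succ i =>
        refine ⟨i.castSucc, by simp [Fin.ext_iff], ?_⟩
        have := hr i.castSucc
        rwa [Fin.succ_castSucc] at this)
    have hright := key _ (hr i) (by
      induction i using Fin.lastCases with
      | last =>
        refine ⟨0, by simp [Fin.ext_iff], ?_⟩
        have := hl 0
        rwa [Fin.castSucc_zero, h0] at this
      | cast i =>
        refine ⟨i.succ, by simp [Fin.ext_iff], ?_⟩
        have := hl i.succ
        rwa [← Fin.succ_castSucc] at this)
    have hlr := hleft.trans hright.symm
    induction i using Fin.lastCases with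
    | last =>
      rw [Fin.succ_last, ← h0] at hlr
      have := @hv (Fin.last _) 0 (by simpa using hlr)
      simp [Fin.ext_iff] at this
    | cast i =>
      rw [Fin.succ_castSucc] at hlr
      have := @hv i.castSucc i.succ hlr
      simp [Fin.ext_iff] at this

end IsRootedBy

/-- The parent vertex of an edge is a vertex at minimal distance from `r`, and that distance serves
as the rank. The absence of cycles makes the edge towards the root unique. -/
theorem MultiHypergraph.IsHypertree.exists_isRootedBy {V : Type*} [DecidableEq V]
    {H : MultiHypergraph V} (hH : H.IsHypertree) (r : V) :
    ∃ f p, IsRootedBy (fun e : H.Edge => e.1) r f p := by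
  classical
  obtain ⟨hc, hac⟩ := hH
  have hconn : ∀ v, (H.linkGraph Set.univ).Reachable v r := by
    intro v
    obtain ⟨w, -, rfl, rfl⟩ := hc v r
    exact w.reachable
  obtain ⟨d, hd0, hd⟩ : ∃ d : V → ℕ, d r = 0 ∧ ∀ x, x ≠ r →
      ∃ (e : H.Edge) (u : V), x ∈ e.1 ∧ u ∈ e.1 ∧ d u < d x := by
    refine ⟨fun v => (H.linkGraph Set.univ).dist v r, by simp, fun x hx => ?_⟩
    obtain ⟨q, hq⟩ := (hconn x).exists_walk_length_eq_dist
    cases q with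
    | nil => exact (hx rfl).elim
    | cons hadj q =>
      obtain ⟨e, -, hxe, hue⟩ := hadj.2
      refine ⟨e, _, hxe, hue, (SimpleGraph.dist_le q).trans_lt ?_⟩
      simp only [← hq]
      exact Nat.lt_succ_self _
  -- Descending from `x` to the root never uses `e`: a step through `e` would reach a vertex of `e`
  -- nearer than `x`.
  have havoid : ∀ (e : H.Edge) (x : V), (∀ u ∈ e.1, d x ≤ d u) →
      (H.linkGraph {e}ᶜ).Reachable r x := by
    intro e x hx
    induction hn : d x using Nat.strong_induction_on generalizing x with
    | _ n ih =>
      by_cases hxr : x = r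
      · rw [hxr]
      · obtain ⟨e', u, hxe', hue', hlt⟩ := hd x hxr
        refine (ih _ (hn ▸ hlt) u (fun w hw => hlt.le.trans (hx w hw)) rfl).trans
          (linkGraph_reachable_of_mem (e := e') ?_ hue' hxe')
        rintro rfl
        exact hlt.not_ge (hx u hue')
  have hpar : ∀ e : H.Edge, ∃ x ∈ e.1, ∀ u ∈ e.1, d x ≤ d u := fun e =>
    Finset.exists_min_image _ _ (Finset.card_pos.1
      (zero_lt_two.trans_le (H.two_le_card _ (Multiset.coe_mem (x := e)))))
  choose p hpm hpd using hpar
  have huniq : ∀ (e e' : H.Edge) (v : V), v ∈ e.1 → v ≠ p e → v ∈ e'.1 → v ≠ p e' → e = e' := by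
    have key : ∀ (e e' : H.Edge) (v : V), v ∈ e.1 → v ≠ p e → v ∈ e'.1 → d (p e') ≤ d (p e) →
        e = e' := by
      intro e e' v hv hvp hv' hle
      by_contra hne
      -- The route from `p e` through `r` and `p e'` to `v` avoids `e`, although `e` contains both
      -- of its ends.
      refine not_reachable_of_forall_not_isCycle hac (hpm e) hv hvp.symm ?_
      exact ((havoid e _ (hpd e)).symm.trans
        (havoid e (p e') fun u hu => hle.trans (hpd e u hu))).trans
        (linkGraph_reachable_of_mem (e := e') (Ne.symm hne) (hpm e') hv')
    intro e e' v hv hvp hv' hvp'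
    rcases le_total (d (p e')) (d (p e)) with h | h
    · exact key e e' v hv hvp hv' h
    · exact (key e' e v hv' hvp' hv h).symm
  have hex : ∀ v, v ≠ r → ∃ e : H.Edge, v ∈ e.1 ∧ d (p e) < d v := by
    intro v hv
    obtain ⟨e, u, hve, hue, hlt⟩ := hd v hv
    exact ⟨e, hve, (hpd e u hue).trans_lt hlt⟩
  have hr : ∀ e : H.Edge, r ∈ e.1 → r = p e := by
    intro e hre
    by_contra hne
    obtain ⟨e', hpe', hlt⟩ := hex (p e) (Ne.symm hne)
    have := hpd e r hre
    omega
  have hlab : ∀ v, ∃ o : Option H.Edge, (o = none ↔ v = r) ∧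
      ∀ e, o = some e ↔ v ∈ e.1 ∧ v ≠ p e := by
    intro v
    by_cases hv : v = r
    · exact ⟨none, by simp [hv], by simpa [hv] using hr⟩
    · obtain ⟨e, he, hlt⟩ := hex v hv
      have hne : v ≠ p e := fun h => by
        rw [← h] at hlt
        exact hlt.false
      refine ⟨some e, by simp [hv], fun e' => ?_⟩
      rw [Option.some_inj]
      exact ⟨fun h => h ▸ ⟨he, hne⟩, fun h => huniq _ _ v he hne h.1 h.2⟩
  choose f hf0 hf using hlab
  refine ⟨f, p, fun e v => ?_, hf0, fun e => ?_, fun e => d (p e), fun e e' he => ?_⟩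
  · rw [hf]
    by_cases hv : v = p e
    · simp [hv, hpm]
    · simp [hv]
  · obtain ⟨v, hv, hne⟩ := Finset.exists_mem_ne
      (H.two_le_card _ (Multiset.coe_mem (x := e))) (p e)
    exact ⟨v, (hf v e).2 ⟨hv, hne⟩⟩
  · obtain ⟨i, hi, hlt⟩ := hex (p e) (mt (hf0 _).2 (by simp [he]))
    have hne : p e ≠ p i := fun h => by
      rw [← h] at hlt
      exact hlt.false
    rwa [huniq e' i (p e) ((hf _ _).1 he).1 ((hf _ _).1 he).2 hi hne]

/-! ### Counting with labelled edges -/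

/-- Partial labellings with fibre `{r}` over `none` are functions on the complement of `r`. -/
def rootedLabellingEquiv {V : Type*} [DecidableEq V] (ι : Type*) (r : V) :
    {f : V → Option ι // (∀ v, f v = none ↔ v = r) ∧ ∀ j, ∃ v, f v = some j} ≃
      {g : {v // v ≠ r} → ι // Function.Surjective g} where
  toFun f := ⟨fun v => (f.1 v).get (Option.isSome_iff_ne_none.2 (mt (f.2.1 v).1 v.2)), fun j => by
    obtain ⟨v, hv⟩ := f.2.2 j
    refine ⟨⟨v, fun h => ?_⟩, by simp [hv]⟩
    rw [(f.2.1 v).2 h] at hv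
    cases hv⟩
  invFun g := ⟨fun v => if h : v = r then none else some (g.1 ⟨v, h⟩), fun v => by simp, fun j => by
    obtain ⟨v, rfl⟩ := g.2 j
    exact ⟨v, by simp [v.2]⟩⟩
  left_inv f := by
    ext1
    funext v
    by_cases h : v = r
    · simp [h, (f.2.1 r).2 rfl]
    · simp [h]
  right_inv g := by
    ext1
    funext v
    simp [v.2]

/-- The labelled data describing a rooted hypertree with edges labelled by `ι`. -/
abbrev RootedData (V ι : Type*) : Type _ :=
  Σ (r : V) (f : {f : V → Option ι // (∀ v, f v = none ↔ v = r) ∧ ∀ j, ∃ v, f v = some j}),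
    {p : ι → V // AcyclicParent f.1 p}

theorem card_rootedData (V ι : Type*) [Fintype V] [Nonempty V] [Finite ι] :
    Nat.card (RootedData V ι) = Fintype.card V ^ Nat.card ι *
      ((Nat.card ι).factorial * Nat.stirlingSecond (Fintype.card V - 1) (Nat.card ι)) := by
  classical
  have : Fintype ι := Fintype.ofFinite ι
  have hpos : 0 < Fintype.card V := Fintype.card_pos
  have hp (r : V) (f : {f : V → Option ι // (∀ v, f v = none ↔ v = r) ∧ ∀ j, ∃ v, f v = some j}) :
      Nat.card {p : ι → V // AcyclicParent f.1 p} * Fintype.card V =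
        Fintype.card V ^ Nat.card ι := by
    rw [card_acyclicParent, Nat.card_congr (Equiv.subtypeEquivRight f.2.1)]
    simp
  have hr (r : V) : Nat.card {v // v ≠ r} = Fintype.card V - 1 := by
    rw [Nat.card_eq_fintype_card]
    simp [Fintype.card_subtype_compl]
  -- The factor `Fintype.card V` avoids the exponent `k - 1`, which would be wrong in truncated
  -- subtraction for `k = 0`.
  apply Nat.eq_of_mul_eq_mul_right hpos
  have hrf (r : V) : Nat.card (Σ f : {f : V → Option ι //
      (∀ v, f v = none ↔ v = r) ∧ ∀ j, ∃ v, f v = some j}, {p : ι → V // AcyclicParent f.1 p}) *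
      Fintype.card V = (Nat.card ι).factorial *
        Nat.stirlingSecond (Fintype.card V - 1) (Nat.card ι) * Fintype.card V ^ Nat.card ι := by
    rw [Nat.card_sigma, Finset.sum_mul, Finset.sum_congr rfl fun f _ => hp r f, Finset.sum_const,
      Finset.card_univ, smul_eq_mul, ← Nat.card_eq_fintype_card (α := {f : V → Option ι // _}),
      Nat.card_congr (rootedLabellingEquiv ι r), card_surjective, hr]
  rw [Nat.card_sigma, Finset.sum_mul, Finset.sum_congr rfl fun r _ => hrf r, Finset.sum_const,
    Finset.card_univ, smul_eq_mul]
  ring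

theorem card_isRootedBy (V ι : Type*) [Fintype V] [Finite ι] :
    Nat.card {x : (ι → Finset V) × V // ∃ f p, IsRootedBy x.1 x.2 f p} =
      Nat.card (RootedData V ι) := by
  classical
  have hD (x : RootedData V ι) : IsRootedBy
      (fun j => insert (x.2.2.1 j) (Finset.univ.filter fun v => x.2.1.1 v = some j))
      x.1 x.2.1.1 x.2.2.1 :=
    ⟨fun j v => by simp, x.2.1.2.1, x.2.1.2.2, x.2.2.2⟩
  symm
  refine Nat.card_eq_of_bijective (fun x => ⟨(_, x.1), _, _, hD x⟩) ⟨fun x y hxy => ?_, ?_⟩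
  · have h1 := congrArg (fun z => z.1.1) hxy
    have h2 := congrArg (fun z => z.1.2) hxy
    have hx := hD x
    have hy := hD y
    clear hxy
    obtain ⟨r, ⟨f, _⟩, ⟨p, _⟩⟩ := x
    obtain ⟨r', ⟨f', _⟩, ⟨p', _⟩⟩ := y
    simp only at h1 h2 hx hy
    rw [h1, h2] at hx
    obtain ⟨rfl, rfl⟩ := hx.unique hy
    subst h2
    rfl
  · rintro ⟨⟨e, r⟩, f, p, h⟩
    refine ⟨⟨r, ⟨f, h.eq_none_iff, h.exists_eq_some⟩, p, h.acyclic⟩, ?_⟩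
    ext j v
    · simp [h.mem_iff]
    · rfl

/-! ### Forgetting the edge labels -/

theorem exists_perm_of_map_univ_eq {ι α : Type*} [Fintype ι] {e e' : ι → α}
    (he : Function.Injective e) (h : Finset.univ.val.map e' = Finset.univ.val.map e) :
    ∃ σ : Equiv.Perm ι, e' = e ∘ σ := by
  have he' : Function.Injective e' := by
    have : (Finset.univ.val.map e').Nodup := h ▸ Finset.univ.nodup.map he
    exact fun i j hij => Multiset.inj_on_of_nodup_map this i (Finset.mem_univ _) j
      (Finset.mem_univ _) hij
  have hex : ∀ j, ∃ i, e i = e' j := by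
    intro j
    have : e' j ∈ Finset.univ.val.map e :=
      h ▸ Multiset.mem_map_of_mem e' (Finset.mem_univ_val j)
    obtain ⟨i, -, hi⟩ := Multiset.mem_map.1 this
    exact ⟨i, hi⟩
  choose s hs using hex
  have hinj : Function.Injective s := fun i j hij => he' (by rw [← hs, ← hs, hij])
  exact ⟨Equiv.ofBijective s (Finite.injective_iff_bijective.1 hinj), funext fun j => (hs j).symm⟩

/-- Enumerations of the edges of rooted hypertrees. -/
theorem exists_isRootedBy_iff {V : Type*} [DecidableEq V] {k : ℕ} (e : Fin k → Finset V) (r : V) :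
    (∃ f p, IsRootedBy e r f p) ↔
      ∃ H : MultiHypergraph V, H.IsHypertree ∧ H.edges = Finset.univ.val.map e := by
  have henum (H : MultiHypergraph V) (h : H.edges = Finset.univ.val.map e) :
      ∃ φ : Fin k ≃ H.Edge, Finset.univ.val.map (fun j => (φ j).1) = Finset.univ.val.map e := by
    have hcard : Fintype.card H.Edge = k := by
      rw [Multiset.card_coe, h]
      simp
    refine ⟨(Fintype.equivFinOfCardEq hcard).symm, ?_⟩
    rw [← h]
    conv_rhs => rw [← Multiset.map_univ_coe H.edges,
      ← Multiset.map_univ_val_equiv (Fintype.equivFinOfCardEq hcard).symm, Multiset.map_map]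
    rfl
  constructor
  · rintro ⟨f, p, h⟩
    let H : MultiHypergraph V := ⟨Finset.univ.val.map e, fun s hs => by
      obtain ⟨j, -, rfl⟩ := Multiset.mem_map.1 hs
      exact h.two_le_card j⟩
    obtain ⟨φ, hφ⟩ := henum H rfl
    obtain ⟨σ, hσ⟩ := exists_perm_of_map_univ_eq h.injective hφ
    have h' := h.comp_equiv (φ.symm.trans σ)
    have he : e ∘ (φ.symm.trans σ) = fun s : H.Edge => s.1 := by
      funext s
      have := congrFun hσ (φ.symm s)
      simpa using this.symm
    rw [he] at h'
    exact ⟨H, h'.isHypertree, rfl⟩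
  · rintro ⟨H, hH, h⟩
    obtain ⟨φ, hφ⟩ := henum H h
    obtain ⟨f, p, hfp⟩ := hH.exists_isRootedBy r
    have h' := hfp.comp_equiv φ
    obtain ⟨σ, rfl⟩ := exists_perm_of_map_univ_eq h'.injective hφ.symm
    exact ⟨_, _, h'.comp_equiv σ⟩

theorem encard_rootedHypertrees_card_eq (V : Type*) [DecidableEq V] [Fintype V] [Nonempty V]
    (k : ℕ) : Set.encard {p ∈ rootedHypertrees V | p.1.edges.card = k} =
      ((Fintype.card V ^ k * Nat.stirlingSecond (Fintype.card V - 1) k : ℕ) : ℕ∞) := by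
  classical
  let E : Finset ((Fin k → Finset V) × V) :=
    Finset.univ.filter fun x => ∃ f p, IsRootedBy x.1 x.2 f p
  let F : (Fin k → Finset V) × V → Multiset (Finset V) × V :=
    fun x => (Finset.univ.val.map x.1, x.2)
  have hE : E.card = Fintype.card V ^ k *
      (k.factorial * Nat.stirlingSecond (Fintype.card V - 1) k) := by
    have := (card_isRootedBy V (Fin k)).trans (card_rootedData V (Fin k))
    rw [Nat.card_eq_fintype_card, Fintype.card_subtype, Nat.card_fin] at this
    exact this
  -- Each fibre is an orbit of the permutations of the labels, and the action is free because the
  -- edges are distinct.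
  have hfib : ∀ b ∈ E.image F, (E.filter fun x => F x = b).card = k.factorial := by
    intro b hb
    obtain ⟨⟨e, r⟩, he, rfl⟩ := Finset.mem_image.1 hb
    obtain ⟨f, p, h⟩ := (Finset.mem_filter.1 he).2
    have him : (E.filter fun x => F x = F (e, r)) =
        Finset.univ.image fun σ : Equiv.Perm (Fin k) => (e ∘ σ, r) := by
      ext ⟨e', r'⟩
      simp only [Finset.mem_filter, Finset.mem_image, Finset.mem_univ, true_and, Prod.mk.injEq, E, F]
      constructor
      · rintro ⟨-, h1, rfl⟩
        obtain ⟨σ, hσ⟩ := exists_perm_of_map_univ_eq h.injective h1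
        exact ⟨σ, hσ.symm, rfl⟩
      · rintro ⟨σ, rfl, rfl⟩
        refine ⟨⟨_, _, h.comp_equiv σ⟩, ?_, rfl⟩
        conv_rhs => rw [← Multiset.map_univ_val_equiv σ, Multiset.map_map]
    rw [him, Finset.card_image_of_injective, Finset.card_univ, Fintype.card_perm, Fintype.card_fin]
    intro σ τ hστ
    ext1 j
    exact h.injective (congrFun (congrArg Prod.fst hστ) j)
  have hcard : (E.image F).card = Fintype.card V ^ k *
      Nat.stirlingSecond (Fintype.card V - 1) k := by
    have h1 := Finset.card_eq_sum_card_image F E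
    rw [Finset.sum_congr rfl hfib, Finset.sum_const, smul_eq_mul, hE] at h1
    apply Nat.eq_of_mul_eq_mul_right k.factorial_pos
    rw [← h1]
    ring
  have hinj : Set.InjOn (fun q : MultiHypergraph V × V => (q.1.edges, q.2))
      {p ∈ rootedHypertrees V | p.1.edges.card = k} := by
    rintro ⟨⟨E1, _⟩, r⟩ - ⟨⟨E2, _⟩, r'⟩ - h
    obtain ⟨rfl, rfl⟩ := Prod.mk.inj h
    rfl
  rw [← hinj.encard_image, ← hcard, ← Set.encard_coe_eq_coe_finsetCard]
  congr 1
  ext ⟨m, r⟩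
  simp only [Set.mem_image, Finset.coe_image, Finset.mem_coe, Finset.mem_filter, Finset.mem_univ,
    true_and, E, F, exists_isRootedBy_iff, Prod.mk.injEq, Prod.exists]
  constructor
  · rintro ⟨H, r, ⟨hH, rfl⟩, rfl, rfl⟩
    obtain ⟨φ⟩ : Nonempty (Fin H.edges.card ≃ H.Edge) :=
      ⟨(Fintype.equivFinOfCardEq (Multiset.card_coe _)).symm⟩
    have hm : Finset.univ.val.map (fun j => (φ j).1) = H.edges := by
      conv_rhs => rw [← Multiset.map_univ_coe H.edges, ← Multiset.map_univ_val_equiv φ,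
        Multiset.map_map]
      rfl
    exact ⟨_, r, ⟨H, hH, hm.symm⟩, hm, rfl⟩
  · rintro ⟨e, r, ⟨H, hH, h⟩, rfl, rfl⟩
    exact ⟨H, r, ⟨hH, by rw [h]; simp⟩, h, rfl⟩

theorem mainTheorem8 (n : ℕ) (hn : 1 ≤ n) :
    (∀ k : ℕ, Set.encard {p ∈ rootedHypertrees (Fin n) | p.1.edges.card = k} =
      ((n ^ k * Nat.stirlingSecond (n - 1) k : ℕ) : ℕ∞)) ∧
    Set.encard (rootedHypertrees (Fin n)) =
      ((∑ k ∈ Finset.range n, n ^ k * Nat.stirlingSecond (n - 1) k : ℕ) : ℕ∞) := by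
  classical
  have : Nonempty (Fin n) := ⟨⟨0, hn⟩⟩
  have hk : ∀ k : ℕ, Set.encard {p ∈ rootedHypertrees (Fin n) | p.1.edges.card = k} =
      ((n ^ k * Nat.stirlingSecond (n - 1) k : ℕ) : ℕ∞) := by
    intro k
    simpa using encard_rootedHypertrees_card_eq (Fin n) k
  refine ⟨hk, ?_⟩
  -- `S(n-1,k)` vanishes for `k ≥ n`, so the count itself bounds the number of edges and yields
  -- finiteness.
  have hlt : ∀ p ∈ rootedHypertrees (Fin n), p.1.edges.card < n := by
    intro p hp
    by_contra hge
    have h0 := hk p.1.edges.card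
    rw [Nat.stirlingSecond_eq_zero_of_lt (by omega), mul_zero, Nat.cast_zero,
      Set.encard_eq_zero] at h0
    exact Set.notMem_empty p (h0 ▸ ⟨hp, rfl⟩)
  have hUnion : rootedHypertrees (Fin n) =
      ⋃ k ∈ Finset.range n, {p ∈ rootedHypertrees (Fin n) | p.1.edges.card = k} := by
    ext p
    simp only [Finset.mem_range, Set.mem_iUnion, Set.mem_ofPred_eq, exists_prop]
    exact ⟨fun hp => ⟨_, hlt p hp, hp, rfl⟩, fun ⟨_, _, hp, _⟩ => hp⟩
  have hfin : (rootedHypertrees (Fin n)).Finite := by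
    rw [hUnion]
    refine (Finset.range n).finite_toSet.biUnion fun k _ => ?_
    rw [← Set.encard_ne_top_iff, hk]
    exact ENat.natCast_ne_top _
  rw [hfin.encard_eq_coe_toFinset_card, Nat.cast_inj,
    Finset.card_eq_sum_card_fiberwise (t := Finset.range n) (f := fun p => p.1.edges.card)
      fun p hp => by simpa using hlt p (by simpa using hp)]
  refine Finset.sum_congr rfl fun k _ => ?_
  rw [← Nat.cast_inj (R := ℕ∞), ← hk, ← Set.encard_coe_eq_coe_finsetCard]
  congr 1
  ext p
  simp
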